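/- Let $\alpha,\varphi,S_0,\hat h_f>0$ be real, let $\mu\ge 1$ be an integer, let $h_l,h_g\neq 0$ be deterministic path gains, let $E_s,E_r,N_{o,1},N_{o,2}>0$ be the transmission powers and noise variances, and let $a,b$ be modulation constants with $b>0$ (e.g. $a=1,b=0.5$ for BPSK; $a=1,b=0.25$ for QPSK; $a=4,b=3/(M-1)$ for $M$-QAM). Write $\Gamma(s,x)=\int_x^\infty t^{s-1}e^{-t}\,dt$ and $Q(x)=\frac1{\sqrt{2\pi}}\int_x^\infty e^{-t^2/2}\,dt$. Let $h_{pf}$ and $h_f$ be random channel coefficients with independent envelopes $|h_{pf}|,|h_f|$, where $|h_{pf}|$ has the density $$f_{|h_{pf}|}(x)=\varphi S_0^{-\varphi}\frac{\mu^{\varphi/\alpha}}{\hat h_f^{\varphi}\,\Gamma(\mu)}\,x^{\varphi-1}\,\Gamma\!\left(\frac{\alpha\mu-\varphi}{\alpha},\ \mu\frac{x^\alpha}{\hat h_f^\alpha}S_0^{-\alpha}\right),\qquad x>0$$ (joint $\alpha$-$\mu$ fading and antenna misalignment in the THz link), and $|h_f|$ is Rayleigh distributed with $\mathbb E|h_f|^2=1$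 (RF link). Let $$\gamma_e=\min(\gamma_1,\gamma_2),\qquad \gamma_1=\frac{|h_l|^2|h_{pf}|^2E_s}{N_{o,1}},\qquad \gamma_2=\frac{|h_g|^2|h_f|^2E_r}{N_{o,2}},$$ be the end-to-end SNR of the mixed THz-RF decode-and-forward system. Then $\gamma_e$ has a density $f_{\gamma_e}$, and the average symbol error rate for the conditional symbol error rate $P_e(x)=a\,Q(\sqrt{2bx})$, namely the convergent integral $\overline P_e=\int_0^\infty P_e(x)f_{\gamma_e}(x)\,dx$, equals $$\overline P_e=\frac a2-a\sqrt{\frac{b}{4\pi}}\,\frac{\varphi\,\mu^{\varphi/\alpha}}{\alpha}\left(\frac{N_{o,1}}{S_0^2\hat h_f^2|h_l|^2E_s}\right)^{\varphi/2}\left(\frac{N_{o,2}}{|h_g|^2E_r}+b\right)^{-\frac{\varphi+1}2}\sum_{k=0}^{\mu-1}\frac1{k!}\,H^{2,2}_{3,3}\!\left(z\,\middle|\begin{array}{c}\left(-\frac{\varphi+1}2,\frac\alpha2\right),\left(\frac{1-\varphi}2,\frac\alpha2\right),(1,1)\\ \left(\frac{\alpha k-\varphi}{\alpha},1\right),(0,1),\left(-\frac{\varphi+1}2,\frac\alpha2\right)\end{array}\right),$$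 $$z=\frac{\mu\left(\frac{N_{o,1}}{|h_l|^2E_s}\right)^{\alpha/2}\frac{1}{\hat h_f^\alpha S_0^\alpha}}{\left(\frac{N_{o,2}}{|h_g|^2E_r}+b\right)^{\alpha/2}}.$$ Here $H^{m,n}_{p,q}$ is the Fox H-function $$H^{m,n}_{p,q}\!\left(z\,\middle|\begin{array}{c}(a_i,\alpha_i)_{i\le p}\\(b_j,\beta_j)_{j\le q}\end{array}\right)=\frac1{2\pi i}\int_{L}\frac{\prod_{j\le m}\Gamma(b_j+\beta_js)\prod_{i\le n}\Gamma(1-a_i-\alpha_is)}{\prod_{i>n}\Gamma(a_i+\alpha_is)\prod_{j>m}\Gamma(1-b_j-\beta_js)}\,z^{-s}\,ds,$$ with $L$ a vertical line, traversed upwards, that has the poles of the $\Gamma(b_j+\beta_js)$, $j\le m$, on its left and those of the $\Gamma(1-a_i-\alpha_is)$, $i\le n$, on its right; for the parameters above such a line exists, and the integral converges absolutely, with the same value for every such line. -/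

import Mathlib

open MeasureTheory ProbabilityTheory Set

noncomputable section

namespace THzRF

/-! ### Special functions -/

/-- The upper incomplete Gamma function `Γ(s, x) = ∫_x^∞ t^(s-1) e^(-t) dt`, for real `s` and
`x > 0`. -/
def upperGamma (s x : ℝ) : ℝ := ∫ t in Ioi x, t ^ (s - 1) * Real.exp (-t)

/-- The Gaussian tail function `Q(x) = (2π)^(-1/2) ∫_x^∞ exp(-t²/2) dt`. -/
def gaussianQ (x : ℝ) : ℝ :=
  (Real.sqrt (2 * Real.pi))⁻¹ * ∫ t in Ioi x, Real.exp (-t ^ 2 / 2)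

/-! ### The Fox H-function

The parameters are an upper row `A : Fin p → ℝ × ℝ` of pairs `(aᵢ, αᵢ)` and a lower row
`B : Fin q → ℝ × ℝ` of pairs `(bⱼ, βⱼ)`. -/

/-- The Mellin-Barnes kernel
`∏_{j ≤ m} Γ(bⱼ + βⱼ s) ∏_{i ≤ n} Γ(1 - aᵢ - αᵢ s) /
  (∏_{i > n} Γ(aᵢ + αᵢ s) ∏_{j > m} Γ(1 - bⱼ - βⱼ s))` of `H^{m,n}_{p,q}`. -/
def foxHKernel (m n : ℕ) {p q : ℕ} (A : Fin p → ℝ × ℝ) (B : Fin q → ℝ × ℝ) (s : ℂ) : ℂ :=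
  ((∏ j : Fin q with j.val < m, Complex.Gamma ((B j).1 + (B j).2 * s)) *
      ∏ i : Fin p with i.val < n, Complex.Gamma (1 - (A i).1 - (A i).2 * s)) /
    ((∏ i : Fin p with n ≤ i.val, Complex.Gamma ((A i).1 + (A i).2 * s)) *
      ∏ j : Fin q with m ≤ j.val, Complex.Gamma (1 - (B j).1 - (B j).2 * s))

/-- The vertical line `re s = c` separates the poles of the factors `Γ(bⱼ + βⱼ s)`, `j ≤ m`
(to its left) from those of the factors `Γ(1 - aᵢ - αᵢ s)`, `i ≤ n` (to its right). -/
def FoxHSeparates (m n : ℕ) {p q : ℕ} (A : Fin p → ℝ × ℝ) (B : Fin q → ℝ × ℝ) (c : ℝ) : Prop :=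
  (∀ j : Fin q, j.val < m → ∀ ν : ℕ, -((B j).1 + ν) / (B j).2 < c) ∧
    ∀ i : Fin p, i.val < n → ∀ ν : ℕ, c < (1 - (A i).1 + ν) / (A i).2

/-- The integrand `t ↦ kernel(s) z^(-s)`, `s = c + i t`, of the Mellin-Barnes integral. -/
def foxHIntegrand (m n : ℕ) {p q : ℕ} (A : Fin p → ℝ × ℝ) (B : Fin q → ℝ × ℝ) (z : ℂ)
    (c t : ℝ) : ℂ :=
  foxHKernel m n A B (c + t * Complex.I) * z ^ (-(c + t * Complex.I : ℂ))

/-- `w` is the value at `z` of the Fox H-function `H^{m,n}_{p,q}`: there is a separating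
vertical line, and for every such line the Mellin-Barnes integral
`(2πi)⁻¹ ∫_{c-i∞}^{c+i∞} kernel(s) z^(-s) ds = (2π)⁻¹ ∫ kernel(c+it) z^(-(c+it)) dt`
converges absolutely to `w`. -/
def HasFoxH (m n : ℕ) {p q : ℕ} (A : Fin p → ℝ × ℝ) (B : Fin q → ℝ × ℝ) (z w : ℂ) : Prop :=
  (∃ c : ℝ, FoxHSeparates m n A B c) ∧
    ∀ c : ℝ, FoxHSeparates m n A B c →
      Integrable (foxHIntegrand m n A B z c) ∧
        (2 * Real.pi : ℂ)⁻¹ * ∫ t : ℝ, foxHIntegrand m n A B z c t = w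

open Classical in
/-- The Fox H-function `H^{m,n}_{p,q}(z)` (with value `0` if there is no `w` as in `HasFoxH`). -/
def foxH (m n : ℕ) {p q : ℕ} (A : Fin p → ℝ × ℝ) (B : Fin q → ℝ × ℝ) (z : ℂ) : ℂ :=
  if h : ∃ w, HasFoxH m n A B z w then h.choose else 0

/-! ### The channels -/

/-- The density on `(0, ∞)` of the envelope of the THz coefficient under joint `α`-`μ` fading
(with `α`-root mean value `hf`) and antenna misalignment (with parameters `φ` and `S₀`). -/
def thzPDF (α φ S₀ hf μ x : ℝ) : ℝ :=
  φ * S₀ ^ (-φ) * (μ ^ (φ / α) / (hf ^ φ * Real.Gamma μ)) * x ^ (φ - 1) *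
    upperGamma ((α * μ - φ) / α) (μ * (x ^ α / hf ^ α) * S₀ ^ (-α))

/-- The law of the envelope of the THz coefficient. -/
def thzLaw (α φ S₀ hf μ : ℝ) : Measure ℝ :=
  (volume.restrict (Ioi 0)).withDensity fun x ↦ ENNReal.ofReal (thzPDF α φ S₀ hf μ x)

/-- The Rayleigh law with mean square `Ω`: density `(2x/Ω) exp(-x²/Ω)` on `(0, ∞)`. -/
def rayleighLaw (Ω : ℝ) : Measure ℝ :=
  (volume.restrict (Ioi 0)).withDensity fun x ↦
    ENNReal.ofReal (2 * x / Ω * Real.exp (-x ^ 2 / Ω))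

/-- The SNR `|g|² |h|² E / N` of a link with deterministic path gain `g`, random channel
coefficient `h`, transmission power `E` and noise variance `N`. -/
def linkSNR {Ω : Type*} (g : ℂ) (h : Ω → ℂ) (E N : ℝ) (ω : Ω) : ℝ :=
  ‖g‖ ^ 2 * ‖h ω‖ ^ 2 * E / N

/-- The end-to-end SNR of the decode-and-forward system: the minimum of the two link SNRs. -/
def e2eSNR {Ω : Type*} (hl hg : ℂ) (hpf hf : Ω → ℂ) (Es Er N₁ N₂ : ℝ) (ω : Ω) : ℝ :=
  min (linkSNR hl hpf Es N₁ ω) (linkSNR hg hf Er N₂ ω)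

/-! ### The symbol error rate -/

/-- The conditional symbol error rate `a Q(√(2 b x))` at SNR `x`. -/
def condSER (a b x : ℝ) : ℝ := a * gaussianQ (Real.sqrt (2 * b * x))

/-- The integrand `P_e(x) f_γ(x)` of the average symbol error rate, `f_γ` being the density
of the SNR `γ`. -/
def serIntegrand {Ω : Type*} [MeasurableSpace Ω] (P : Measure Ω) (γ : Ω → ℝ) (a b x : ℝ) : ℝ :=
  condSER a b x * (pdf γ P volume x).toReal

/-- The average symbol error rate `∫_0^∞ P_e(x) f_γ(x) dx`. -/
def averageSER {Ω : Type*} [MeasurableSpace Ω] (P : Measure Ω) (γ : Ω → ℝ) (a b : ℝ) : ℝ :=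
  ∫ x in Ioi 0, serIntegrand P γ a b x

/-! ### The H-functions in the average symbol error rate -/

/-- Upper parameters of the H-functions in the average symbol error rate. -/
def serUpper (α φ : ℝ) : Fin 3 → ℝ × ℝ :=
  ![(-((φ + 1) / 2), α / 2), ((1 - φ) / 2, α / 2), (1, 1)]

/-- Lower parameters of the `k`-th H-function in the average symbol error rate. -/
def serLower (α φ : ℝ) (k : ℕ) : Fin 3 → ℝ × ℝ :=
  ![((α * k - φ) / α, 1), (0, 1), (-((φ + 1) / 2), α / 2)]

/-- Argument of the H-functions in the average symbol error rate. -/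
def serArg (α S₀ hf μ : ℝ) (hl hg : ℂ) (Es Er N₁ N₂ b : ℝ) : ℝ :=
  μ * (N₁ / (‖hl‖ ^ 2 * Es)) ^ (α / 2) * (1 / (hf ^ α * S₀ ^ α)) /
    (N₂ / (‖hg‖ ^ 2 * Er) + b) ^ (α / 2)

end THzRF

end

namespace THzRF

/-! ### The upper incomplete Gamma function -/

/-! Averaging `Q(√(2bγ))` needs only the tail of `γ`: writing `Q` as a Gaussian integral and
swapping the order gives `E Q(√(2bγ)) = 1/2 - (2π)^(-1/2) ∫₀^∞ exp(-t²/2) P(γ ≥ t²/(2b)) dt`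
(`integrable_gaussianQ_and_integral_eq`).

For a minimum of independent SNRs the tail is a product. The Rayleigh link contributes an
exponential. The THz link contributes `thzSurvival`, a finite sum of incomplete Gamma functions:
since `μ` is an integer, the recurrence for `Γ(s+1, y)` makes the derivative of that sum telescope
to minus the density (`sum_upperGamma_telescope`).

Rescaling `t²` merges the two exponentials and leaves, for each `k`, the integral of `v^((φ+1)/2-1)
exp(-v) Γ(k-φ/α, z v^(α/2))`. Mellin inversion of `exp(-x)` gives `Γ(a, y)` as the line integral of
`Γ(a+s) y^(-s)/s`; integrating over `v` adds the factor `Γ((φ+1)/2 - αs/2)`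
(`integral_upperGamma_eq_integral_Gamma`). This is the H-function kernel once its repeated parameter
cancels and `Γ(s)/Γ(1+s)` becomes `1/s` (`foxHKernel_ser`). -/

lemma integrableOn_rpow_mul_exp_neg (s : ℝ) {y : ℝ} (hy : 0 < y) :
    IntegrableOn (fun t : ℝ ↦ t ^ (s - 1) * Real.exp (-t)) (Ioi y) := by
  refine integrable_of_isBigO_exp_neg (b := 1 / 2) (by norm_num) ?_ ?_
  · refine ContinuousOn.mul (fun t ht ↦ ?_) (by fun_prop)
    exact (Real.continuousAt_rpow_const _ _ (Or.inl (hy.trans_le ht).ne')).continuousWithinAt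
  · simpa only [mul_comm (Real.exp _)] using (Real.Gamma_integrand_isLittleO (s - 1)).isBigO

lemma upperGamma_nonneg (s : ℝ) {y : ℝ} (hy : 0 ≤ y) : 0 ≤ upperGamma s y :=
  setIntegral_nonneg measurableSet_Ioi fun _ ht ↦
    mul_nonneg (Real.rpow_nonneg (hy.trans (le_of_lt ht)) _) (Real.exp_pos _).le

/-- Integrals are based at `y / 2` rather than `0`, because for `s ≤ 0` the integrand is not
integrable at the origin; such `s` do occur, e.g. `-φ/α`. -/
lemma hasDerivAt_upperGamma (s : ℝ) {y : ℝ} (hy : 0 < y) :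
    HasDerivAt (upperGamma s) (-(y ^ (s - 1) * Real.exp (-y))) y := by
  have hy2 : 0 < y / 2 := by positivity
  have hcont : ∀ x : ℝ, 0 < x → ContinuousAt (fun t : ℝ ↦ t ^ (s - 1) * Real.exp (-t)) x :=
    fun x hx ↦ (Real.continuousAt_rpow_const _ _ (Or.inl hx.ne')).mul (by fun_prop)
  have hInt : ∀ x : ℝ, 0 < x →
      IntervalIntegrable (fun t : ℝ ↦ t ^ (s - 1) * Real.exp (-t)) volume (y / 2) x := by
    intro x hx
    refine ContinuousOn.intervalIntegrable fun t ht ↦ (hcont t ?_).continuousWithinAt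
    exact (lt_min hy2 hx).trans_le ht.1
  have hmeas : StronglyMeasurableAtFilter (fun t : ℝ ↦ t ^ (s - 1) * Real.exp (-t)) (nhds y) :=
    (by fun_prop : Measurable fun t : ℝ ↦ t ^ (s - 1) * Real.exp (-t)).stronglyMeasurable
      |>.stronglyMeasurableAtFilter
  have key := (intervalIntegral.integral_hasDerivAt_right (hInt y hy) hmeas
    (hcont y hy)).const_sub (upperGamma s (y / 2))
  refine key.congr_of_eventuallyEq ?_
  filter_upwards [lt_mem_nhds hy] with x hx
  rw [eq_sub_iff_add_eq, add_comm]
  exact intervalIntegral.integral_interval_add_Ioi' (hInt x hx)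
    (integrableOn_rpow_mul_exp_neg s hx)

lemma tendsto_upperGamma_atTop (s : ℝ) :
    Filter.Tendsto (upperGamma s) Filter.atTop (nhds 0) :=
  tendsto_integral_Ioi_zero Filter.tendsto_id

/-- On the range of integration `y^q ≤ t^q`. Together with the vanishing of every `upperGamma` at
infinity, this gives decay faster than any power without asymptotics. -/
lemma rpow_mul_upperGamma_le (s : ℝ) {q y : ℝ} (hq : 0 ≤ q) (hy : 0 < y) :
    y ^ q * upperGamma s y ≤ upperGamma (s + q) y := by
  rw [upperGamma, ← integral_const_mul]
  refine setIntegral_mono_on ((integrableOn_rpow_mul_exp_neg s hy).const_mul _)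
    (integrableOn_rpow_mul_exp_neg _ hy) measurableSet_Ioi fun t ht ↦ ?_
  have ht0 : 0 < t := hy.trans ht
  rw [show s + q - 1 = q + (s - 1) by ring, Real.rpow_add ht0, ← mul_assoc]
  gcongr
  exact le_of_lt ht

lemma tendsto_rpow_mul_upperGamma_atTop (s : ℝ) {q : ℝ} (hq : 0 ≤ q) :
    Filter.Tendsto (fun y ↦ y ^ q * upperGamma s y) Filter.atTop (nhds 0) := by
  refine squeeze_zero' ?_ ?_ (tendsto_upperGamma_atTop (s + q))
  · filter_upwards [Filter.eventually_ge_atTop 0] with y hy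
    exact mul_nonneg (Real.rpow_nonneg hy _) (upperGamma_nonneg s hy)
  · filter_upwards [Filter.eventually_gt_atTop 0] with y hy
    exact rpow_mul_upperGamma_le s hq hy

/-- Integration by parts, in the form of the derivative of `t^s exp(-t)` integrated over `(y, ∞)`.
-/
lemma upperGamma_add_one (s : ℝ) {y : ℝ} (hy : 0 < y) :
    upperGamma (s + 1) y = s * upperGamma s y + y ^ s * Real.exp (-y) := by
  have hd : ∀ x ∈ Ici y, HasDerivAt (fun t : ℝ ↦ t ^ s * Real.exp (-t))
      (s * (x ^ (s - 1) * Real.exp (-x)) - x ^ (s + 1 - 1) * Real.exp (-x)) x := by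
    intro x hx
    have hx0 : 0 < x := hy.trans_le hx
    have h1 := (Real.hasDerivAt_rpow_const (p := s) (Or.inl hx0.ne')).mul
      (hasDerivAt_neg x).exp
    refine h1.congr_deriv ?_
    rw [add_sub_cancel_right]
    ring
  have hi := ((integrableOn_rpow_mul_exp_neg s hy).const_mul s).sub
    (integrableOn_rpow_mul_exp_neg (s + 1) hy)
  have h := integral_Ioi_of_hasDerivAt_of_tendsto' hd hi (m := 0) (by
    simpa using tendsto_rpow_mul_exp_neg_mul_atTop_nhds_zero s 1 one_pos)
  rw [integral_sub ((integrableOn_rpow_mul_exp_neg s hy).const_mul s)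
    (integrableOn_rpow_mul_exp_neg (s + 1) hy), integral_const_mul] at h
  simp only [upperGamma]
  linarith

/-! ### The Gamma function on vertical lines -/

lemma norm_Gamma_le_Gamma_re {s : ℂ} (hs : 0 < s.re) : ‖Complex.Gamma s‖ ≤ Real.Gamma s.re := by
  rw [Complex.Gamma_eq_integral hs, Real.Gamma_eq_integral hs, Complex.GammaIntegral]
  refine (norm_integral_le_integral_norm _).trans_eq (setIntegral_congr_fun measurableSet_Ioi ?_)
  intro x hx
  simp only [norm_mul, Complex.norm_cpow_eq_rpow_re_of_pos hx, Complex.sub_re, Complex.one_re,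
    Complex.norm_real, Real.norm_eq_abs, abs_of_pos (Real.exp_pos _)]

lemma continuous_Gamma_vertical {c : ℝ} (hc : 0 < c) (r : ℝ) :
    Continuous fun t : ℝ ↦ Complex.Gamma (c + r * t * Complex.I) := by
  refine continuous_iff_continuousAt.2 fun t ↦ ?_
  refine ContinuousAt.comp (f := fun t : ℝ ↦ (c + r * t * Complex.I : ℂ))
    (Complex.differentiableAt_Gamma _ fun m h ↦ ?_).continuousAt (by fun_prop)
  have := congrArg Complex.re h
  simp at this
  have : (0 : ℝ) ≤ m := by positivity
  linarith

lemma integrable_inv_sq_add_sq {δ : ℝ} (hδ : 0 < δ) :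
    Integrable fun t : ℝ ↦ (δ ^ 2 + t ^ 2)⁻¹ := by
  have h := (integrable_inv_one_add_sq.comp_mul_left' (inv_ne_zero hδ.ne')).const_mul (δ ^ 2)⁻¹
  refine h.congr (Filter.Eventually.of_forall fun t ↦ ?_)
  simp only
  field_simp

lemma norm_inv_mul_inv_vertical_le {c c' : ℝ} (hc : 0 < c) (hc' : 0 < c') (t : ℝ) :
    ‖(c + t * Complex.I : ℂ)‖⁻¹ * ‖(c' + t * Complex.I : ℂ)‖⁻¹ ≤ (min c c' ^ 2 + t ^ 2)⁻¹ := by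
  have hm : 0 < min c c' := lt_min hc hc'
  have key : ∀ x : ℝ, min c c' ≤ x →
      Real.sqrt (min c c' ^ 2 + t ^ 2) ≤ ‖(x + t * Complex.I : ℂ)‖ := by
    intro x hx
    rw [Complex.norm_add_mul_I]
    gcongr
  rw [← mul_inv]
  refine inv_anti₀ (by positivity) ?_
  rw [← Real.mul_self_sqrt (show 0 ≤ min c c' ^ 2 + t ^ 2 by positivity)]
  exact mul_le_mul (key c (min_le_left _ _)) (key c' (min_le_right _ _))
    (Real.sqrt_nonneg _) (norm_nonneg _)

lemma ne_zero_of_re_pos {s : ℂ} (hs : 0 < s.re) : s ≠ 0 := by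
  rintro rfl
  simp at hs

/-- One use of the functional equation, `Γ(w) = Γ(w+1)/w`, with `Γ(w+1)` bounded on the line, gives
decay `1/|w|`; the denominator gives a second factor, hence a bound of order `t⁻²`. No Stirling
estimate is needed. -/
lemma integrable_Gamma_div {a c : ℝ} (hc : 0 < c) (hac : 0 < a + c) :
    Integrable fun t : ℝ ↦
      Complex.Gamma (a + (c + t * Complex.I)) / (c + t * Complex.I) := by
  have hre : ∀ t : ℝ, 0 < ((c : ℂ) + t * Complex.I).re := fun t ↦ by simpa using hc
  have hre' : ∀ t : ℝ, 0 < ((a : ℂ) + (c + t * Complex.I)).re := fun t ↦ by simpa using hac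
  refine Integrable.mono' ((integrable_inv_sq_add_sq (lt_min hac hc)).const_mul
    (Real.Gamma (a + c + 1))) ?_ (Filter.Eventually.of_forall fun t ↦ ?_)
  · refine Continuous.aestronglyMeasurable (Continuous.div ?_ (by fun_prop)
      fun t ↦ ne_zero_of_re_pos (hre t))
    simpa [add_assoc] using continuous_Gamma_vertical hac 1
  · have hG := norm_Gamma_le_Gamma_re (s := a + (c + t * Complex.I) + 1)
      (by simpa using by linarith)
    rw [Complex.Gamma_add_one _ (ne_zero_of_re_pos (hre' t)), norm_mul] at hG
    have hp : 0 < ‖(a : ℂ) + (c + t * Complex.I)‖ := norm_pos_iff.2 (ne_zero_of_re_pos (hre' t))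
    have hb := norm_inv_mul_inv_vertical_le hac hc t
    rw [norm_div, div_eq_mul_inv]
    calc ‖Complex.Gamma (a + (c + t * Complex.I))‖ * ‖(c + t * Complex.I : ℂ)‖⁻¹
        = (‖(a : ℂ) + (c + t * Complex.I)‖ * ‖Complex.Gamma (a + (c + t * Complex.I))‖) *
          (‖((a + c : ℝ) : ℂ) + t * Complex.I‖⁻¹ * ‖(c + t * Complex.I : ℂ)‖⁻¹) := by
          push_cast
          rw [← add_assoc] at hp ⊢
          field_simp
      _ ≤ Real.Gamma (a + c + 1) * (min (a + c) c ^ 2 + t ^ 2)⁻¹ := by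
          refine mul_le_mul (hG.trans_eq ?_) hb (by positivity)
            (Real.Gamma_pos_of_pos (by linarith)).le
          simp

lemma integrable_Gamma_vertical {c : ℝ} (hc : 0 < c) :
    Integrable fun t : ℝ ↦ Complex.Gamma (c + t * Complex.I) := by
  -- With `a = 1` the quotient `Γ(1+s)/s` is `Γ(s)` itself.
  have h := integrable_Gamma_div (a := 1) hc (by linarith)
  refine h.congr (Filter.Eventually.of_forall fun t ↦ ?_)
  have hne : (c + t * Complex.I : ℂ) ≠ 0 := ne_zero_of_re_pos (by simpa using hc)
  simp only [Complex.ofReal_one]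
  rw [add_comm, Complex.Gamma_add_one _ hne, mul_div_cancel_left₀ _ hne]

/-! ### Mellin-Barnes representations -/

lemma exp_neg_eq_integral_Gamma {c x : ℝ} (hc : 0 < c) (hx : 0 < x) :
    (2 * Real.pi : ℂ)⁻¹ * ∫ t : ℝ, Complex.Gamma (c + t * Complex.I) *
      (x : ℂ) ^ (-(c + t * Complex.I : ℂ)) = (Real.exp (-x) : ℂ) := by
  have hG : ∀ t : ℝ, mellin (fun x : ℝ ↦ (Real.exp (-x) : ℂ)) (c + t * Complex.I) =
      Complex.Gamma (c + t * Complex.I) := fun t ↦ by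
    rw [← Complex.GammaIntegral_eq_mellin, Complex.Gamma_eq_integral (by simpa using hc)]
  have h := mellinInv_mellin_eq c (fun x : ℝ ↦ (Real.exp (-x) : ℂ)) hx ?_ ?_ ?_
  · rw [← h, mellinInv]
    simp only [hG, smul_eq_mul, Complex.real_smul]
    push_cast
    rw [one_div]
    congr 2
    funext t
    rw [mul_comm]
  · have := Complex.GammaIntegral_convergent (s := c) (by simpa using hc)
    refine this.congr_fun (fun x _ ↦ ?_) measurableSet_Ioi
    simp [mul_comm]
  · rw [Complex.VerticalIntegrable]
    simp only [hG]
    exact integrable_Gamma_vertical hc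
  · fun_prop

lemma continuousOn_ofReal_cpow_uncurry {c : ℝ} {y : ℝ} (hy : 0 ≤ y) (p : ℝ) :
    ContinuousOn (fun q : ℝ × ℝ ↦ (q.1 : ℂ) ^ (p - (c + q.2 * Complex.I) : ℂ))
      (Ioi y ×ˢ univ) := by
  intro q hq
  refine ContinuousAt.continuousWithinAt ?_
  refine ContinuousAt.cpow (by fun_prop) (by fun_prop) (Or.inl ?_)
  simpa using hy.trans_lt hq.1

/-- Mellin inversion of `exp(-x)` is applied on the line of real part `a + c`, so `a` may be
negative. The factor `x^(a-1)` turns `x^(-(a+s))` into `x^(-1-s)`, whose integral over `(y, ∞)` is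
`y^(-s)/s`. -/
lemma upperGamma_eq_integral_Gamma {a c y : ℝ} (hc : 0 < c) (hac : 0 < a + c) (hy : 0 < y) :
    (2 * Real.pi : ℂ)⁻¹ * ∫ t : ℝ, Complex.Gamma (a + (c + t * Complex.I)) /
      (c + t * Complex.I) * (y : ℂ) ^ (-(c + t * Complex.I : ℂ)) = (upperGamma a y : ℂ) := by
  have hInt : Integrable (Function.uncurry fun (x t : ℝ) ↦
      Complex.Gamma (a + (c + t * Complex.I)) * (x : ℂ) ^ (-1 - (c + t * Complex.I) : ℂ))
      ((volume.restrict (Ioi y)).prod volume) := by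
    have hx : IntegrableOn (fun x : ℝ ↦ x ^ (-1 - c)) (Ioi y) :=
      integrableOn_Ioi_rpow_of_lt (by linarith) hy
    have hGi : Integrable fun t : ℝ ↦ Complex.Gamma (a + (c + t * Complex.I)) := by
      simpa [add_assoc] using integrable_Gamma_vertical hac
    refine Integrable.mono' (hx.mul_prod hGi.norm) ?_ ?_
    -- The integrand is continuous only on the strip, so the product measure is rewritten as
    -- Lebesgue measure restricted to it.
    · have hm : Measure.prod (volume.restrict (Ioi y)) volume =
          (volume : Measure (ℝ × ℝ)).restrict (Ioi y ×ˢ univ) := by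
        rw [Measure.volume_eq_prod, ← Measure.prod_restrict, Measure.restrict_univ]
      rw [hm]
      refine ContinuousOn.aestronglyMeasurable ?_ (measurableSet_Ioi.prod MeasurableSet.univ)
      refine ContinuousOn.mul ?_ (by
        simpa using continuousOn_ofReal_cpow_uncurry (c := c) hy.le (-1))
      have := (continuous_Gamma_vertical hac 1).comp (continuous_snd (X := ℝ) (Y := ℝ))
      simpa [add_assoc, Function.comp_def] using this.continuousOn
    · have : ∀ᵐ q : ℝ × ℝ ∂(volume.restrict (Ioi y)).prod volume, q.1 ∈ Ioi y :=
        Measure.quasiMeasurePreserving_fst.ae (ae_restrict_mem measurableSet_Ioi)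
      filter_upwards [this] with q hq
      have hq0 : 0 < q.1 := hy.trans hq
      simp only [Function.uncurry, norm_mul, Complex.norm_cpow_eq_rpow_re_of_pos hq0]
      rw [mul_comm]
      simp
  have hswap := integral_integral_swap hInt
  have hl : ∫ x in Ioi y, ∫ t : ℝ, Complex.Gamma (a + (c + t * Complex.I)) *
      (x : ℂ) ^ (-1 - (c + t * Complex.I) : ℂ) =
      ∫ x in Ioi y, (2 * Real.pi : ℂ) * ((x ^ (a - 1) * Real.exp (-x) : ℝ) : ℂ) := by
    refine setIntegral_congr_fun measurableSet_Ioi fun x hx ↦ ?_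
    have hx0 : 0 < x := hy.trans hx
    have hxc : (x : ℂ) ≠ 0 := by exact_mod_cast hx0.ne'
    have h := exp_neg_eq_integral_Gamma hac hx0
    have hpi : (2 * Real.pi : ℂ) ≠ 0 := by
      exact_mod_cast Real.two_pi_pos.ne'
    rw [inv_mul_eq_iff_eq_mul₀ hpi] at h
    rw [Complex.ofReal_mul, mul_left_comm, ← h, Complex.ofReal_cpow hx0.le, ← integral_const_mul]
    congr 1
    funext t
    rw [mul_left_comm, ← Complex.cpow_add _ _ hxc]
    push_cast
    congr 2 <;> ring
  have hr : ∀ t : ℝ, ∫ x in Ioi y, Complex.Gamma (a + (c + t * Complex.I)) *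
      (x : ℂ) ^ (-1 - (c + t * Complex.I) : ℂ) = Complex.Gamma (a + (c + t * Complex.I)) /
      (c + t * Complex.I) * (y : ℂ) ^ (-(c + t * Complex.I : ℂ)) := by
    intro t
    rw [integral_const_mul, integral_Ioi_cpow_of_lt (by simpa using hc) hy]
    rw [show (-1 - (c + t * Complex.I) + 1 : ℂ) = -(c + t * Complex.I) by ring, neg_div_neg_eq]
    ring
  simp only [hr] at hswap
  rw [← hswap, hl, integral_const_mul, ← mul_assoc, inv_mul_cancel₀, one_mul, integral_complex_ofReal]
  · rfl
  · exact_mod_cast Real.two_pi_pos.ne'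

/-- The Mellin-Barnes representation of a Gamma mixture of incomplete Gamma functions. -/
lemma integral_upperGamma_eq_integral_Gamma {a c d p z : ℝ} (hc : 0 < c) (hac : 0 < a + c)
    (hd : 0 < d - p * c) (hz : 0 < z) :
    IntegrableOn (fun v : ℝ ↦ v ^ (d - 1) * Real.exp (-v) * upperGamma a (z * v ^ p)) (Ioi 0) ∧
    (2 * Real.pi : ℂ)⁻¹ * ∫ t : ℝ, Complex.Gamma (a + (c + t * Complex.I)) /
      (c + t * Complex.I) * Complex.Gamma (d - p * (c + t * Complex.I)) *
        (z : ℂ) ^ (-(c + t * Complex.I : ℂ)) =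
      ((∫ v in Ioi (0 : ℝ), v ^ (d - 1) * Real.exp (-v) * upperGamma a (z * v ^ p) : ℝ) : ℂ) := by
  -- Fubini for the integrand with `v^(d-1) (v^p)^(-s)` already merged into one power: integrating
  -- in `t` yields the incomplete Gamma function, integrating in `v` yields `Γ(d - p s)`.
  have hInt : Integrable (Function.uncurry fun (v t : ℝ) ↦ ((Real.exp (-v) : ℝ) : ℂ) *
      (Complex.Gamma (a + (c + t * Complex.I)) / (c + t * Complex.I) *
        (z : ℂ) ^ (-(c + t * Complex.I : ℂ))) *
      (v : ℂ) ^ ((d - 1 : ℝ) - (((p * c : ℝ) : ℂ) + (p * t : ℝ) * Complex.I) : ℂ))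
      ((volume.restrict (Ioi 0)).prod volume) := by
    have hv := Real.GammaIntegral_convergent hd
    have hGi := (integrable_Gamma_div hc hac).norm.mul_const (z ^ (-c))
    refine Integrable.mono' (hv.mul_prod hGi) ?_ ?_
    · have hm : Measure.prod (volume.restrict (Ioi (0 : ℝ))) (volume : Measure ℝ) =
          (volume : Measure (ℝ × ℝ)).restrict (Ioi 0 ×ˢ univ) := by
        rw [Measure.volume_eq_prod, ← Measure.prod_restrict, Measure.restrict_univ]
      rw [hm]
      refine ContinuousOn.aestronglyMeasurable ?_ (measurableSet_Ioi.prod MeasurableSet.univ)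
      refine ContinuousOn.mul ?_ ?_
      · refine Continuous.continuousOn (Continuous.mul (by fun_prop) (Continuous.mul ?_ ?_))
        · refine Continuous.div ?_ (by fun_prop) fun q ↦ ne_zero_of_re_pos (by simpa using hc)
          have := (continuous_Gamma_vertical hac 1).comp (continuous_snd (X := ℝ) (Y := ℝ))
          simpa [add_assoc, Function.comp_def] using this
        · refine Continuous.const_cpow (by fun_prop) (Or.inl ?_)
          exact_mod_cast hz.ne'
      · intro q hq
        refine ContinuousAt.continuousWithinAt
          (ContinuousAt.cpow (by fun_prop) (by fun_prop) (Or.inl ?_))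
        simpa using hq.1
    · have : ∀ᵐ q : ℝ × ℝ ∂(volume.restrict (Ioi 0)).prod volume, q.1 ∈ Ioi (0 : ℝ) :=
        Measure.quasiMeasurePreserving_fst.ae (ae_restrict_mem measurableSet_Ioi)
      filter_upwards [this] with q hq
      have hq0 : 0 < q.1 := hq
      simp only [Function.uncurry, norm_mul, Complex.norm_cpow_eq_rpow_re_of_pos hq0,
        Complex.norm_cpow_eq_rpow_re_of_pos hz, Complex.norm_real, Real.norm_eq_abs,
        abs_of_pos (Real.exp_pos _)]
      simp [sub_right_comm, mul_right_comm]
  have hswap := integral_integral_swap hInt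
  have hpi : (2 * Real.pi : ℂ) ≠ 0 := by exact_mod_cast Real.two_pi_pos.ne'
  have hl : ∀ v : ℝ, v ∈ Ioi 0 → ∫ t : ℝ, ((Real.exp (-v) : ℝ) : ℂ) *
      (Complex.Gamma (a + (c + t * Complex.I)) / (c + t * Complex.I) *
        (z : ℂ) ^ (-(c + t * Complex.I : ℂ))) *
      (v : ℂ) ^ ((d - 1 : ℝ) - (((p * c : ℝ) : ℂ) + (p * t : ℝ) * Complex.I) : ℂ) =
      (2 * Real.pi : ℂ) *
        ((v ^ (d - 1) * Real.exp (-v) * upperGamma a (z * v ^ p) : ℝ) : ℂ) := by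
    intro v (hv : 0 < v)
    have hvc : (v : ℂ) ≠ 0 := by exact_mod_cast hv.ne'
    have hvp : 0 < v ^ p := Real.rpow_pos_of_pos hv p
    have h := upperGamma_eq_integral_Gamma hc hac (mul_pos hz hvp)
    rw [inv_mul_eq_iff_eq_mul₀ hpi] at h
    rw [Complex.ofReal_mul (v ^ (d - 1) * Real.exp (-v)), mul_left_comm, ← h, ← integral_const_mul]
    congr 1
    funext t
    rw [Complex.ofReal_mul z, Complex.mul_cpow_ofReal_nonneg hz.le hvp.le,
      Complex.ofReal_mul (v ^ (d - 1)), Complex.ofReal_cpow hv.le, Complex.ofReal_cpow hv.le]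
    -- Multiplying exponents is not valid for general complex powers; here `v^p` is a positive real,
    -- so its logarithm is `p log v`.
    have e : ((v : ℂ) ^ (p : ℂ)) ^ (-(c + t * Complex.I : ℂ)) =
        (v : ℂ) ^ (-(((p * c : ℝ) : ℂ) + (p * t : ℝ) * Complex.I)) := by
      rw [← Complex.ofReal_cpow hv.le, Complex.cpow_def_of_ne_zero
        (by exact_mod_cast hvp.ne'), Complex.cpow_def_of_ne_zero hvc, ← Complex.ofReal_log hvp.le,
        Real.log_rpow hv, ← Complex.ofReal_log hv.le]
      push_cast
      congr 1
      ring
    rw [e, sub_eq_add_neg, Complex.cpow_add _ _ hvc]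
    ring
  have hr : ∀ t : ℝ, ∫ v in Ioi (0 : ℝ), ((Real.exp (-v) : ℝ) : ℂ) *
      (Complex.Gamma (a + (c + t * Complex.I)) / (c + t * Complex.I) *
        (z : ℂ) ^ (-(c + t * Complex.I : ℂ))) *
      (v : ℂ) ^ ((d - 1 : ℝ) - (((p * c : ℝ) : ℂ) + (p * t : ℝ) * Complex.I) : ℂ) =
      Complex.Gamma (a + (c + t * Complex.I)) /
      (c + t * Complex.I) * Complex.Gamma (d - p * (c + t * Complex.I)) *
        (z : ℂ) ^ (-(c + t * Complex.I : ℂ)) := by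
    intro t
    have hre : 0 < (d - p * (c + t * Complex.I) : ℂ).re := by simpa using hd
    rw [Complex.Gamma_eq_integral hre, Complex.GammaIntegral, mul_right_comm,
      ← integral_const_mul]
    refine setIntegral_congr_fun measurableSet_Ioi fun v _ ↦ ?_
    rw [mul_comm ((Real.exp (-v) : ℝ) : ℂ), mul_assoc]
    congr 3
    push_cast
    ring
  simp only [hr] at hswap
  refine ⟨?_, ?_⟩
  · have h : IntegrableOn (fun v : ℝ ↦ (2 * Real.pi : ℂ) *
        ((v ^ (d - 1) * Real.exp (-v) * upperGamma a (z * v ^ p) : ℝ) : ℂ)) (Ioi 0) :=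
      IntegrableOn.congr_fun hInt.integral_prod_left hl measurableSet_Ioi
    have h' := (h.const_mul (2 * Real.pi : ℂ)⁻¹).re
    refine h'.congr (Filter.Eventually.of_forall fun v ↦ ?_)
    simp only
    rw [← mul_assoc, inv_mul_cancel₀ hpi, one_mul]
    rfl
  rw [← hswap, setIntegral_congr_fun measurableSet_Ioi hl, integral_const_mul, ← mul_assoc, inv_mul_cancel₀ hpi, one_mul, integral_complex_ofReal]

lemma integrable_Gamma_div_mul_Gamma {a c d p z : ℝ} (hc : 0 < c) (hac : 0 < a + c)
    (hd : 0 < d - p * c) (hz : 0 < z) :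
    Integrable fun t : ℝ ↦ Complex.Gamma (a + (c + t * Complex.I)) /
      (c + t * Complex.I) * Complex.Gamma (d - p * (c + t * Complex.I)) *
        (z : ℂ) ^ (-(c + t * Complex.I : ℂ)) := by
  have hf : Continuous fun t : ℝ ↦ Complex.Gamma (d - p * (c + t * Complex.I)) *
      (z : ℂ) ^ (-(c + t * Complex.I : ℂ)) := by
    refine Continuous.mul ?_ (Continuous.const_cpow (by fun_prop) (Or.inl ?_))
    · convert continuous_Gamma_vertical hd (-p) using 3
      push_cast
      ring
    · exact_mod_cast hz.ne'
  simp only [mul_assoc]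
  refine Integrable.mul_bdd (c := Real.Gamma (d - p * c) * z ^ (-c))
    (integrable_Gamma_div hc hac) hf.aestronglyMeasurable
    (Filter.Eventually.of_forall fun t ↦ ?_)
  have h := norm_Gamma_le_Gamma_re (s := d - p * (c + t * Complex.I)) (by simpa using hd)
  rw [norm_mul, Complex.norm_cpow_eq_rpow_re_of_pos hz]
  refine mul_le_mul (by simpa using h) (by simp) (by positivity) (Real.Gamma_pos_of_pos hd).le

/-! ### The Fox H-functions of the average symbol error rate -/

/-- Uniqueness rests on the existence clause of `HasFoxH`: without a separating line every `w` would
qualify vacuously. -/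
lemma HasFoxH.unique {m n p q : ℕ} {A : Fin p → ℝ × ℝ} {B : Fin q → ℝ × ℝ} {z w w' : ℂ}
    (h : HasFoxH m n A B z w) (h' : HasFoxH m n A B z w') : w = w' := by
  obtain ⟨c, hc⟩ := h.1
  rw [← (h.2 c hc).2, (h'.2 c hc).2]

lemma HasFoxH.foxH_eq {m n p q : ℕ} {A : Fin p → ℝ × ℝ} {B : Fin q → ℝ × ℝ} {z w : ℂ}
    (h : HasFoxH m n A B z w) : foxH m n A B z = w := by
  have hex : ∃ w, HasFoxH m n A B z w := ⟨w, h⟩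
  rw [foxH, dif_pos hex]
  exact hex.choose_spec.unique h

lemma foxHKernel_ser {α φ : ℝ} {k : ℕ} {s : ℂ} (hs : 0 < s.re)
    (hd : 0 < (φ + 1) / 2 - α / 2 * s.re) :
    foxHKernel 2 2 (serUpper α φ) (serLower α φ k) s =
      Complex.Gamma (((α * k - φ) / α : ℝ) + s) / s *
        Complex.Gamma (((φ + 1) / 2 : ℝ) - (α / 2 : ℝ) * s) := by
  have hs0 := ne_zero_of_re_pos hs
  have hG : Complex.Gamma s ≠ 0 := Complex.Gamma_ne_zero_of_re_pos hs
  have hG' : Complex.Gamma (1 + (((φ + 1) / 2 : ℝ) : ℂ) - (α / 2 : ℝ) * s) ≠ 0 := by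
    refine Complex.Gamma_ne_zero_of_re_pos ?_
    simp only [Complex.sub_re, Complex.add_re, Complex.one_re, Complex.ofReal_re,
      Complex.re_ofReal_mul]
    linarith
  have e1 : Complex.Gamma (1 + s) = s * Complex.Gamma s := by
    rw [add_comm, Complex.Gamma_add_one _ hs0]
  have e2 : (1 : ℂ) - (((1 - φ) / 2 : ℝ) : ℂ) = (((φ + 1) / 2 : ℝ) : ℂ) := by
    push_cast
    ring
  have e3 : (1 : ℂ) - ((-((φ + 1) / 2) : ℝ) : ℂ) = 1 + (((φ + 1) / 2 : ℝ) : ℂ) := by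
    push_cast
    ring
  simp only [foxHKernel, Finset.prod_filter, Fin.prod_univ_three, serUpper, serLower,
    Matrix.cons_val_zero, Matrix.cons_val_one, Matrix.cons_val]
  simp only [Fin.val_zero, Fin.val_one, Fin.val_two, Nat.zero_lt_two, Nat.one_lt_two, lt_irrefl,
    if_true, if_false, nonpos_iff_eq_zero, OfNat.ofNat_ne_zero, Nat.not_ofNat_le_one, le_refl, one_mul, mul_one,
    Complex.ofReal_one, Complex.ofReal_zero, zero_add, e1, e2, e3]
  -- This factor comes from the parameter `(-(φ+1)/2, α/2)`, which occurs in both rows and therefore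
  -- cancels.
  generalize Complex.Gamma (1 + (((φ + 1) / 2 : ℝ) : ℂ) - (α / 2 : ℝ) * s) = g at *
  field_simp

/-- The H-functions in the average symbol error rate as integrals of incomplete Gamma
functions. -/
lemma hasFoxH_ser {α φ z : ℝ} (hα : 0 < α) (hφ : 0 < φ) (hz : 0 < z) (k : ℕ) :
    HasFoxH 2 2 (serUpper α φ) (serLower α φ k) (z : ℂ)
      ((∫ v in Ioi (0 : ℝ), v ^ ((φ + 1) / 2 - 1) * Real.exp (-v) *
        upperGamma ((α * k - φ) / α) (z * v ^ (α / 2)) : ℝ) : ℂ) := by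
  -- The midpoint of `(φ/α, (φ+1)/α)`. The left end is the first pole of `Γ(k - φ/α + s)` in the
  -- worst case `k = 0`; the right end is the first pole of `Γ((φ+1)/2 - αs/2)`.
  refine ⟨⟨(φ + 1 / 2) / α, ?_, ?_⟩, fun c hc ↦ ?_⟩
  · intro j hj ν
    have hν : (0 : ℝ) ≤ ν := Nat.cast_nonneg ν
    have hk : (0 : ℝ) ≤ k := Nat.cast_nonneg k
    fin_cases j
    · simp only [serLower, Fin.zero_eta, Matrix.cons_val_zero, div_one]
      rw [neg_lt_iff_pos_add, show (φ + 1 / 2) / α + ((α * k - φ) / α + ν) =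
        k + ν + 1 / 2 / α by field_simp; ring]
      positivity
    · simp only [serLower, Fin.mk_one, Matrix.cons_val_one, Matrix.cons_val_zero, div_one]
      have : 0 < (φ + 1 / 2) / α := by positivity
      linarith
    · simp at hj
  · intro i hi ν
    have hν : (0 : ℝ) ≤ ν := Nat.cast_nonneg ν
    fin_cases i
    · simp only [serUpper, Fin.zero_eta, Matrix.cons_val_zero]
      rw [div_lt_div_iff₀ hα (by positivity)]
      nlinarith [mul_nonneg hα.le hν, mul_pos hα hφ]
    · simp only [serUpper, Fin.mk_one, Matrix.cons_val_one, Matrix.cons_val_zero]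
      rw [div_lt_div_iff₀ hα (by positivity)]
      nlinarith [mul_nonneg hα.le hν]
    · simp at hi
  -- For an arbitrary separating line, only the leading poles (`ν = 0`) are needed.
  · have h0 : 0 < c := by simpa [serLower] using hc.1 1 (by simp) 0
    have h1 : 0 < (α * k - φ) / α + c := by
      have := hc.1 0 (by simp) 0
      simp only [serLower, Matrix.cons_val_zero, div_one, Nat.cast_zero, add_zero] at this
      linarith
    have h2 : 0 < (φ + 1) / 2 - α / 2 * c := by
      have := hc.2 1 (by simp) 0
      simp only [serUpper, Matrix.cons_val_one, Matrix.cons_val_zero, Nat.cast_zero, add_zero]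
        at this
      rw [lt_div_iff₀ (by positivity)] at this
      linarith
    have hK : foxHIntegrand 2 2 (serUpper α φ) (serLower α φ k) (z : ℂ) c = fun t : ℝ ↦
        Complex.Gamma (((α * k - φ) / α : ℝ) + (c + t * Complex.I)) / (c + t * Complex.I) *
          Complex.Gamma (((φ + 1) / 2 : ℝ) - (α / 2 : ℝ) * (c + t * Complex.I)) *
          (z : ℂ) ^ (-(c + t * Complex.I : ℂ)) := by
      funext t
      rw [foxHIntegrand, foxHKernel_ser (by simpa using h0) (by simpa using h2)]
    rw [hK]
    exact ⟨integrable_Gamma_div_mul_Gamma h0 h1 h2 hz,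
      (integral_upperGamma_eq_integral_Gamma h0 h1 h2 hz).2⟩

lemma integrableOn_rpow_mul_exp_neg_mul_upperGamma {α φ z : ℝ} (hα : 0 < α) (hφ : 0 < φ)
    (hz : 0 < z) (k : ℕ) :
    IntegrableOn (fun v : ℝ ↦ v ^ ((φ + 1) / 2 - 1) * Real.exp (-v) *
      upperGamma ((α * k - φ) / α) (z * v ^ (α / 2))) (Ioi 0) := by
  refine (integral_upperGamma_eq_integral_Gamma (c := (φ + 1 / 2) / α) (by positivity) ?_ ?_ hz).1
  · rw [show (α * k - φ) / α + (φ + 1 / 2) / α = k + 1 / 2 / α by field_simp; ring]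
    positivity
  · rw [show (φ + 1) / 2 - α / 2 * ((φ + 1 / 2) / α) = 1 / 4 by field_simp; ring]
    norm_num

/-! ### Survival functions of the envelopes -/

/-- The fundamental theorem of calculus at infinity; the constant sign of the derivative supplies
integrability. -/
lemma measure_Ici_withDensity_eq {f F : ℝ → ℝ} {r : ℝ} (hr : 0 < r)
    (hf : ∀ x, 0 < x → 0 ≤ f x) (hF : ∀ x, 0 < x → HasDerivAt F (-f x) x)
    (hlim : Filter.Tendsto F Filter.atTop (nhds 0)) :
    ((volume.restrict (Ioi 0)).withDensity fun x ↦ ENNReal.ofReal (f x)) (Ici r) =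
      ENNReal.ofReal (F r) := by
  have hd : ∀ x ∈ Ici r, HasDerivAt F (-f x) x := fun x hx ↦ hF x (hr.trans_le hx)
  have hneg : ∀ x ∈ Ioi r, -f x ≤ 0 := fun x hx ↦ neg_nonpos.2 (hf x (hr.trans hx))
  have hi := integrableOn_Ioi_deriv_of_nonpos' hd hneg hlim
  have hv := integral_Ioi_of_hasDerivAt_of_nonpos' hd hneg hlim
  rw [integral_neg, zero_sub, neg_inj] at hv
  have hi' : IntegrableOn f (Ioi r) := integrable_neg_iff.1 hi
  rw [withDensity_apply _ measurableSet_Ici, Measure.restrict_restrict measurableSet_Ici,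
    inter_eq_left.2 (show Ici r ⊆ Ioi 0 from fun x hx ↦ hr.trans_le hx),
    setLIntegral_congr Ioi_ae_eq_Ici.symm, ← hv,
    ofReal_integral_eq_lintegral_ofReal hi']
  filter_upwards [ae_restrict_mem measurableSet_Ioi] with x hx using hf x (hr.trans hx)

lemma rayleighLaw_one_Ici {r : ℝ} (hr : 0 < r) :
    rayleighLaw 1 (Ici r) = ENNReal.ofReal (Real.exp (-r ^ 2)) := by
  refine measure_Ici_withDensity_eq (F := fun r ↦ Real.exp (-r ^ 2)) hr
    (fun x hx ↦ by positivity) (fun x _ ↦ ?_) ?_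
  · refine ((hasDerivAt_pow 2 x).neg.exp).congr_deriv ?_
    simp
    ring
  · exact Real.tendsto_exp_neg_atTop_nhds_zero.comp (Filter.tendsto_pow_atTop two_ne_zero)

/-- The survival function of the envelope of the THz coefficient. -/
noncomputable def thzSurvival (α φ m : ℝ) (μ : ℕ) (r : ℝ) : ℝ :=
  φ / α * m ^ (φ / α) * ∑ k ∈ Finset.range μ,
    1 / (k.factorial : ℝ) * (r ^ φ * upperGamma ((α * k - φ) / α) (m * r ^ α))

/-- With `a_k = k - φ/α`, the recurrence turns the bracket into `αk Γ(a_k, y) - α Γ(a_(k+1), y)`.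
Dividing by `k!` gives consecutive differences of `α Γ(a_k, y)/(k-1)!`, the first of these being
absent for `k = 0`. -/
lemma sum_upperGamma_telescope {α φ y : ℝ} (hα : 0 < α) (hy : 0 < y) (n : ℕ) :
    ∑ k ∈ Finset.range (n + 1), 1 / (k.factorial : ℝ) *
      (φ * upperGamma ((α * k - φ) / α) y - α * (y ^ ((α * k - φ) / α) * Real.exp (-y))) =
      -(α / (n.factorial : ℝ) * upperGamma ((α * (n + 1 : ℕ) - φ) / α) y) := by
  have hrec : ∀ k : ℕ, upperGamma ((α * (k + 1 : ℕ) - φ) / α) y =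
      (α * k - φ) / α * upperGamma ((α * k - φ) / α) y +
        y ^ ((α * k - φ) / α) * Real.exp (-y) := fun k ↦ by
    rw [← upperGamma_add_one _ hy]
    congr 1
    push_cast
    field_simp
    ring
  induction n with
  | zero =>
    rw [Finset.sum_range_one, hrec 0]
    simp only [Nat.factorial_zero, Nat.cast_one, Nat.cast_zero, mul_zero, zero_sub]
    field_simp
    ring
  | succ n ih =>
    rw [Finset.sum_range_succ, ih, hrec (n + 1), Nat.factorial_succ]
    have : (n.factorial : ℝ) ≠ 0 := by positivity
    push_cast
    field_simp
    ring

lemma hasDerivAt_thzSurvival {α φ m x : ℝ} (hα : 0 < α) (hm : 0 < m) (hx : 0 < x) (n : ℕ) :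
    HasDerivAt (thzSurvival α φ m (n + 1))
      (-(φ * (m ^ (φ / α) / n.factorial) * x ^ (φ - 1) *
        upperGamma ((α * (n + 1 : ℕ) - φ) / α) (m * x ^ α))) x := by
  have hy : 0 < m * x ^ α := by positivity
  have hk : ∀ k ∈ Finset.range (n + 1), HasDerivAt
      (fun r : ℝ ↦ 1 / (k.factorial : ℝ) * (r ^ φ * upperGamma ((α * k - φ) / α) (m * r ^ α)))
      (x ^ (φ - 1) * (1 / (k.factorial : ℝ) * (φ * upperGamma ((α * k - φ) / α) (m * x ^ α) -
        α * ((m * x ^ α) ^ ((α * k - φ) / α) * Real.exp (-(m * x ^ α)))))) x := by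
    intro k _
    have h1 := Real.hasDerivAt_rpow_const (p := φ) (Or.inl hx.ne')
    have h2 := (Real.hasDerivAt_rpow_const (p := α) (Or.inl hx.ne')).const_mul m
    have h3 := (hasDerivAt_upperGamma ((α * k - φ) / α) hy).comp x h2
    refine ((h1.mul h3).const_mul (1 / (k.factorial : ℝ))).congr_deriv ?_
    rw [Real.rpow_sub_one hy.ne', Real.rpow_sub_one hx.ne', Real.rpow_sub_one hx.ne']
    simp only [Function.comp]
    field_simp
    ring
  refine ((HasDerivAt.fun_sum hk).const_mul (φ / α * m ^ (φ / α))).congr_deriv ?_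
  rw [← Finset.mul_sum, sum_upperGamma_telescope hα hy]
  field_simp

lemma tendsto_thzSurvival {α φ m : ℝ} (hα : 0 < α) (hφ : 0 < φ) (hm : 0 < m) (μ : ℕ) :
    Filter.Tendsto (thzSurvival α φ m μ) Filter.atTop (nhds 0) := by
  have hk : ∀ k ∈ Finset.range μ, Filter.Tendsto (fun r : ℝ ↦
      1 / (k.factorial : ℝ) * (r ^ φ * upperGamma ((α * k - φ) / α) (m * r ^ α)))
      Filter.atTop (nhds 0) := by
    intro k _
    have hlim : Filter.Tendsto (fun r : ℝ ↦ m * r ^ α) Filter.atTop Filter.atTop :=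
      (tendsto_rpow_atTop hα).const_mul_atTop hm
    -- Up to the constant `m^(-φ/α)`, `r^φ` is the power `φ/α` of the argument `m r^α`.
    have h := ((tendsto_rpow_mul_upperGamma_atTop ((α * k - φ) / α)
      (div_pos hφ hα).le).comp hlim).const_mul (1 / (k.factorial : ℝ) * (m ^ (φ / α))⁻¹)
    rw [mul_zero] at h
    refine h.congr' ?_
    filter_upwards [Filter.eventually_gt_atTop 0] with r hr
    have hmp : 0 < m ^ (φ / α) := Real.rpow_pos_of_pos hm _
    simp only [Function.comp]
    rw [Real.mul_rpow hm.le (Real.rpow_nonneg hr.le _), ← Real.rpow_mul hr.le,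
      mul_div_cancel₀ _ hα.ne']
    field_simp
  have h := (tendsto_finsetSum _ hk).const_mul (φ / α * m ^ (φ / α))
  rw [Finset.sum_const_zero, mul_zero] at h
  exact h

lemma mul_one_div_rpow_div {α S₀ hhat μ : ℝ} (hα : 0 < α) (hS₀ : 0 < S₀)
    (hhhat : 0 < hhat) (hμ : 0 ≤ μ) (φ : ℝ) :
    (μ * (1 / (hhat ^ α * S₀ ^ α))) ^ (φ / α) = μ ^ (φ / α) / (hhat ^ φ * S₀ ^ φ) := by
  rw [mul_one_div, Real.div_rpow hμ (by positivity), Real.mul_rpow (by positivity)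
    (by positivity), ← Real.rpow_mul hhhat.le, ← Real.rpow_mul hS₀.le, mul_div_cancel₀ _ hα.ne']

lemma thzLaw_Ici {α φ S₀ hhat r : ℝ} (hα : 0 < α) (hφ : 0 < φ) (hS₀ : 0 < S₀)
    (hhhat : 0 < hhat) {μ : ℕ} (hμ : 1 ≤ μ) (hr : 0 < r) :
    thzLaw α φ S₀ hhat μ (Ici r) =
      ENNReal.ofReal (thzSurvival α φ (μ * (1 / (hhat ^ α * S₀ ^ α))) μ r) := by
  obtain ⟨n, rfl⟩ : ∃ n, μ = n + 1 := ⟨μ - 1, by omega⟩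
  have hμ0 : (0 : ℝ) < (n + 1 : ℕ) := by positivity
  have hm : 0 < ((n + 1 : ℕ) : ℝ) * (1 / (hhat ^ α * S₀ ^ α)) := by positivity
  have hpdf : ∀ x, 0 < x → thzPDF α φ S₀ hhat (n + 1 : ℕ) x =
      φ * ((((n + 1 : ℕ) : ℝ) * (1 / (hhat ^ α * S₀ ^ α))) ^ (φ / α) / n.factorial) *
        x ^ (φ - 1) * upperGamma ((α * (n + 1 : ℕ) - φ) / α)
          ((((n + 1 : ℕ) : ℝ) * (1 / (hhat ^ α * S₀ ^ α))) * x ^ α) := by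
    intro x hx
    have e1 : ((n + 1 : ℕ) : ℝ) * (x ^ α / hhat ^ α) * S₀ ^ (-α) =
        (((n + 1 : ℕ) : ℝ) * (1 / (hhat ^ α * S₀ ^ α))) * x ^ α := by
      rw [Real.rpow_neg hS₀.le]
      field_simp
    rw [thzPDF, e1, mul_one_div_rpow_div hα hS₀ hhhat hμ0.le, Real.rpow_neg hS₀.le]
    have hG : Real.Gamma ((n + 1 : ℕ) : ℝ) = n.factorial := by
      rw [Nat.cast_add_one, Real.Gamma_nat_eq_factorial]
    rw [hG]
    field_simp
  refine measure_Ici_withDensity_eq hr (fun x hx ↦ ?_) (fun x hx ↦ ?_)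
    (tendsto_thzSurvival hα hφ hm _)
  · rw [hpdf x hx]
    have := upperGamma_nonneg ((α * (n + 1 : ℕ) - φ) / α)
      (mul_nonneg hm.le (Real.rpow_nonneg hx.le α))
    positivity
  · rw [hpdf x hx]
    exact hasDerivAt_thzSurvival hα hm hx n

/-! ### The Gaussian tail function -/

lemma integrable_exp_neg_sq_div_two : Integrable fun t : ℝ ↦ Real.exp (-t ^ 2 / 2) := by
  refine (integrable_exp_neg_mul_sq (b := 1 / 2) (by norm_num)).congr
    (Filter.Eventually.of_forall fun t ↦ ?_)
  simp only
  congr 1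
  ring

lemma integral_exp_neg_sq_div_two_Ioi :
    ∫ t in Ioi (0 : ℝ), Real.exp (-t ^ 2 / 2) = Real.sqrt (2 * Real.pi) / 2 := by
  have h := integral_gaussian_Ioi (1 / 2)
  rw [show Real.pi / (1 / 2) = 2 * Real.pi by ring] at h
  rw [← h]
  congr 1
  funext t
  congr 1
  ring

lemma gaussianQ_sqrt_eq (x : ℝ) :
    gaussianQ (Real.sqrt x) = (Real.sqrt (2 * Real.pi))⁻¹ *
      ∫ t in Ioi (0 : ℝ), (Ioi (Real.sqrt x)).indicator (fun t ↦ Real.exp (-t ^ 2 / 2)) t := by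
  rw [gaussianQ, setIntegral_indicator measurableSet_Ioi, Ioi_inter_Ioi,
    max_eq_right (Real.sqrt_nonneg x)]

lemma integrable_indicator_Ioi_sqrt (ν : Measure ℝ) [IsProbabilityMeasure ν] (b : ℝ) :
    Integrable (Function.uncurry fun x t : ℝ ↦
      (Ioi (Real.sqrt (2 * b * x))).indicator (fun t ↦ Real.exp (-t ^ 2 / 2)) t)
      (ν.prod (volume.restrict (Ioi 0))) := by
  have hg := (integrable_exp_neg_sq_div_two.integrableOn (s := Ioi 0)).comp_snd ν
  have hs : MeasurableSet {q : ℝ × ℝ | Real.sqrt (2 * b * q.1) < q.2} :=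
    measurableSet_lt (by fun_prop) (by fun_prop)
  refine (hg.indicator hs).congr (Filter.Eventually.of_forall fun q ↦ ?_)
  simp only [Function.uncurry, indicator, mem_ofPred_eq, mem_Ioi]

lemma integral_indicator_Ioi_sqrt (ν : Measure ℝ) [IsProbabilityMeasure ν] {b t : ℝ}
    (hb : 0 < b) (ht : 0 < t) :
    ∫ x, (Ioi (Real.sqrt (2 * b * x))).indicator (fun t ↦ Real.exp (-t ^ 2 / 2)) t ∂ν =
      Real.exp (-t ^ 2 / 2) - Real.exp (-t ^ 2 / 2) * ν.real (Ici (t ^ 2 / (2 * b))) := by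
  have h : ∀ x, (Ioi (Real.sqrt (2 * b * x))).indicator (fun t ↦ Real.exp (-t ^ 2 / 2)) t =
      (Iio (t ^ 2 / (2 * b))).indicator (fun _ ↦ Real.exp (-t ^ 2 / 2)) x := by
    intro x
    -- Valid for negative `x` too, where `Real.sqrt` is `0` and `t > 0`; so `ν` may charge the
    -- negative axis.
    have : t ∈ Ioi (Real.sqrt (2 * b * x)) ↔ x ∈ Iio (t ^ 2 / (2 * b)) := by
      rw [mem_Ioi, mem_Iio, Real.sqrt_lt' ht, lt_div_iff₀ (by positivity), mul_comm]
    simp only [indicator, this]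
  simp only [h]
  rw [integral_indicator_const _ measurableSet_Iio, ← compl_Ici,
    probReal_compl_eq_one_sub measurableSet_Ici, smul_eq_mul]
  ring

/-- The mean of `Q(√(2 b x))` in terms of the survival function. -/
lemma integrable_gaussianQ_and_integral_eq (ν : Measure ℝ) [IsProbabilityMeasure ν] {b : ℝ}
    (hb : 0 < b) :
    Integrable (fun x ↦ gaussianQ (Real.sqrt (2 * b * x))) ν ∧
      ∫ x, gaussianQ (Real.sqrt (2 * b * x)) ∂ν = 1 / 2 - (Real.sqrt (2 * Real.pi))⁻¹ *
        ∫ t in Ioi (0 : ℝ), Real.exp (-t ^ 2 / 2) * ν.real (Ici (t ^ 2 / (2 * b))) := by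
  have hInt := integrable_indicator_Ioi_sqrt ν b
  simp only [gaussianQ_sqrt_eq]
  refine ⟨hInt.integral_prod_left.const_mul _, ?_⟩
  have hsub : ∀ t ∈ Ioi (0 : ℝ), ∫ x, (Ioi (Real.sqrt (2 * b * x))).indicator
      (fun t ↦ Real.exp (-t ^ 2 / 2)) t ∂ν = Real.exp (-t ^ 2 / 2) -
        Real.exp (-t ^ 2 / 2) * ν.real (Ici (t ^ 2 / (2 * b))) :=
    fun t ht ↦ integral_indicator_Ioi_sqrt ν hb ht
  have hg := integrable_exp_neg_sq_div_two.integrableOn (s := Ioi 0)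
  have hI : IntegrableOn (fun t : ℝ ↦ Real.exp (-t ^ 2 / 2) -
      Real.exp (-t ^ 2 / 2) * ν.real (Ici (t ^ 2 / (2 * b)))) (Ioi 0) :=
    IntegrableOn.congr_fun hInt.integral_prod_right hsub measurableSet_Ioi
  have hS : IntegrableOn (fun t : ℝ ↦
      Real.exp (-t ^ 2 / 2) * ν.real (Ici (t ^ 2 / (2 * b)))) (Ioi 0) := by
    refine (hg.sub hI).congr (Filter.Eventually.of_forall fun t ↦ ?_)
    simp
  rw [integral_const_mul, integral_integral_swap hInt,
    setIntegral_congr_fun measurableSet_Ioi hsub, integral_sub hg hS,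
    integral_exp_neg_sq_div_two_Ioi, mul_sub]
  congr 1
  have : Real.sqrt (2 * Real.pi) ≠ 0 := (Real.sqrt_pos.2 Real.two_pi_pos).ne'
  field_simp

lemma measurable_gaussianQ : Measurable gaussianQ := by
  refine Antitone.measurable fun x y hxy ↦ ?_
  refine mul_le_mul_of_nonneg_left ?_ (by positivity)
  exact setIntegral_mono_set integrable_exp_neg_sq_div_two.integrableOn
    (Filter.Eventually.of_forall fun t ↦ (Real.exp_pos _).le)
    (Ioi_subset_Ioi hxy).eventuallyLE

/-- The average symbol error rate in terms of the survival function of the SNR. -/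
lemma integrableOn_serIntegrand_and_averageSER_eq {Ω : Type*} [MeasurableSpace Ω]
    (P : Measure Ω) [IsProbabilityMeasure P] (γ : Ω → ℝ) [HasPDF γ P volume]
    (hγ : ∀ᵐ ω ∂P, 0 < γ ω) (a : ℝ) {b : ℝ} (hb : 0 < b) :
    IntegrableOn (serIntegrand P γ a b) (Ioi 0) ∧
      averageSER P γ a b = a * (1 / 2 - (Real.sqrt (2 * Real.pi))⁻¹ *
        ∫ t in Ioi (0 : ℝ), Real.exp (-t ^ 2 / 2) * P.real {ω | t ^ 2 / (2 * b) ≤ γ ω}) := by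
  have hγm : AEMeasurable γ P := HasPDF.aemeasurable γ P volume
  have : IsProbabilityMeasure (P.map γ) := Measure.isProbabilityMeasure_map hγm
  have hmeas : Measurable (condSER a b) :=
    (measurable_gaussianQ.comp (by fun_prop)).const_mul a
  -- The error rate is cut off to `(0, ∞)`, the domain of `averageSER`; as `γ > 0` almost surely,
  -- the cutoff does not change its mean.
  have hfm : AEStronglyMeasurable ((Ioi 0).indicator (condSER a b)) volume :=
    (hmeas.indicator measurableSet_Ioi).aestronglyMeasurable
  have hind : (Ioi 0).indicator (serIntegrand P γ a b) = fun x ↦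
      (pdf γ P volume x).toReal • (Ioi 0).indicator (condSER a b) x := by
    funext x
    by_cases hx : x ∈ Ioi (0 : ℝ)
    · simp [hx, serIntegrand, mul_comm]
    · simp [hx]
  have hae : (fun ω ↦ (Ioi 0).indicator (condSER a b) (γ ω)) =ᵐ[P] fun ω ↦ condSER a b (γ ω) := by
    filter_upwards [hγ] with ω hω
    exact indicator_of_mem (show γ ω ∈ Ioi 0 from hω) _
  obtain ⟨hQi, hQ⟩ := integrable_gaussianQ_and_integral_eq (P.map γ) hb
  refine ⟨?_, ?_⟩
  · rw [← integrable_indicator_iff measurableSet_Ioi, hind, pdf.integrable_pdf_smul_iff hfm,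
      integrable_congr hae]
    exact ((integrable_map_measure hmeas.aestronglyMeasurable hγm).1 (hQi.const_mul a))
  · rw [averageSER, ← integral_indicator measurableSet_Ioi, hind, pdf.integral_pdf_smul hfm,
      integral_congr_ae hae, ← integral_map hγm hmeas.aestronglyMeasurable]
    simp only [condSER]
    rw [integral_const_mul, hQ]
    simp only [map_measureReal_apply_of_aemeasurable hγm measurableSet_Ici]
    rfl

/-! ### The law of the end-to-end SNR -/

/-- The positive part of the preimage of a null set is contained in its image under `y ↦ √(y/C)`,
which is differentiable on `(0, ∞)` and so preserves null sets. -/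
lemma map_mul_sq_absolutelyContinuous {Ω : Type*} [MeasurableSpace Ω] {P : Measure Ω}
    {X : Ω → ℝ} (hX : AEMeasurable X P) (hac : P.map X ≪ volume.restrict (Ioi 0)) {C : ℝ}
    (hC : 0 < C) : P.map (fun ω ↦ C * X ω ^ 2) ≪ volume := by
  refine Measure.AbsolutelyContinuous.mk fun N hN hN0 ↦ ?_
  have hm : Measurable fun x : ℝ ↦ C * x ^ 2 := by fun_prop
  have hCX : AEMeasurable (fun ω ↦ C * X ω ^ 2) P := hm.comp_aemeasurable hX
  rw [Measure.map_apply_of_aemeasurable hCX hN,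
    show (fun ω ↦ C * X ω ^ 2) ⁻¹' N = X ⁻¹' ((fun x ↦ C * x ^ 2) ⁻¹' N) from rfl,
    ← Measure.map_apply_of_aemeasurable hX (hm hN)]
  refine hac ?_
  rw [Measure.restrict_apply (hm hN)]
  have hd : DifferentiableOn ℝ (fun y : ℝ ↦ Real.sqrt (y / C)) (N ∩ Ioi 0) := fun y hy ↦
    DifferentiableAt.differentiableWithinAt
      (DifferentiableAt.sqrt (by fun_prop) (div_pos hy.2 hC).ne')
  refine measure_mono_null ?_ (addHaar_image_eq_zero_of_differentiableOn_of_addHaar_eq_zero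
    volume hd (measure_mono_null inter_subset_left hN0))
  rintro x ⟨hx, hx0 : 0 < x⟩
  refine ⟨C * x ^ 2, ⟨hx, by simp only [mem_Ioi]; positivity⟩, ?_⟩
  simp only
  rw [mul_div_cancel_left₀ _ hC.ne', Real.sqrt_sq hx0.le]

/-- The minimum always equals one of the two variables, so independence plays no role. -/
lemma map_min_absolutelyContinuous {Ω : Type*} [MeasurableSpace Ω] {P : Measure Ω}
    {X Y : Ω → ℝ} (hX : AEMeasurable X P) (hY : AEMeasurable Y P) (hXac : P.map X ≪ volume)
    (hYac : P.map Y ≪ volume) : P.map (fun ω ↦ min (X ω) (Y ω)) ≪ volume := by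
  refine Measure.AbsolutelyContinuous.mk fun N hN hN0 ↦ ?_
  rw [Measure.map_apply_of_aemeasurable (hX.min hY) hN]
  have h1 := hXac hN0
  have h2 := hYac hN0
  rw [Measure.map_apply_of_aemeasurable hX hN] at h1
  rw [Measure.map_apply_of_aemeasurable hY hN] at h2
  refine measure_mono_null (fun ω hω ↦ ?_) (measure_union_null h1 h2)
  rcases min_choice (X ω) (Y ω) with h | h
  · exact Or.inl (by simpa only [mem_preimage, h] using hω)
  · exact Or.inr (by simpa only [mem_preimage, h] using hω)

lemma linkSNR_eq {Ω : Type*} (g : ℂ) (h : Ω → ℂ) (E N : ℝ) :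
    linkSNR g h E N = fun ω ↦ ‖g‖ ^ 2 * E / N * ‖h ω‖ ^ 2 := by
  funext ω
  rw [linkSNR]
  ring

lemma le_linkSNR_iff {Ω : Type*} {g : ℂ} (hg : g ≠ 0) (h : Ω → ℂ) {E N : ℝ} (hE : 0 < E)
    (hN : 0 < N) (x : ℝ) (ω : Ω) :
    x ≤ linkSNR g h E N ω ↔ Real.sqrt (x * (N / (‖g‖ ^ 2 * E))) ≤ ‖h ω‖ := by
  have hg' : 0 < ‖g‖ := norm_pos_iff.2 hg
  rw [Real.sqrt_le_left (norm_nonneg _), linkSNR, le_div_iff₀ hN, mul_div_assoc',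
    div_le_iff₀ (by positivity)]
  ring_nf

lemma ae_pos_of_map_absolutelyContinuous {Ω : Type*} [MeasurableSpace Ω] {P : Measure Ω}
    {X : Ω → ℝ} (hX : AEMeasurable X P) (hac : P.map X ≪ volume.restrict (Ioi 0)) :
    ∀ᵐ ω ∂P, 0 < X ω :=
  ae_of_ae_map hX (hac.ae_le (ae_restrict_mem measurableSet_Ioi))

/-! ### The average symbol error rate -/

lemma integral_comp_sq_Ioi (G : ℝ → ℝ) {κ : ℝ} (hκ : 0 < κ) :
    ∫ t in Ioi (0 : ℝ), G (t ^ 2 / κ) =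
      Real.sqrt κ / 2 * ∫ v in Ioi (0 : ℝ), v ^ (-(1 / 2) : ℝ) * G v := by
  have h := integral_comp_rpow_Ioi_of_pos (g := fun y ↦ 1 / 2 * y ^ (-(1 / 2) : ℝ) * G (κ⁻¹ * y))
    (p := 2) (by norm_num)
  have hl : ∫ t in Ioi (0 : ℝ), G (t ^ 2 / κ) = ∫ x in Ioi (0 : ℝ), (2 * x ^ (2 - 1 : ℝ)) •
      (1 / 2 * (x ^ (2 : ℝ)) ^ (-(1 / 2) : ℝ) * G (κ⁻¹ * x ^ (2 : ℝ))) := by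
    refine setIntegral_congr_fun measurableSet_Ioi fun x (hx : 0 < x) ↦ ?_
    rw [← Real.rpow_mul hx.le, show (2 : ℝ) * -(1 / 2) = -1 by norm_num,
      show (2 - 1 : ℝ) = 1 by norm_num, Real.rpow_one, Real.rpow_neg_one, Real.rpow_two,
      smul_eq_mul, inv_mul_eq_div]
    field_simp
  have h2 := integral_comp_mul_left_Ioi' (fun v ↦ v ^ (-(1 / 2) : ℝ) * G v) 0 (inv_pos.2 hκ)
  rw [mul_zero] at h2
  rw [hl, h, ← h2, smul_eq_mul, ← integral_const_mul, ← integral_const_mul]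
  refine setIntegral_congr_fun measurableSet_Ioi fun y (hy : 0 < y) ↦ ?_
  rw [Real.mul_rpow (inv_pos.2 hκ).le hy.le, Real.inv_rpow hκ.le, Real.rpow_neg hκ.le, inv_inv,
    ← Real.sqrt_eq_rpow]
  have := Real.mul_self_sqrt hκ.le
  have hs : 0 < Real.sqrt κ := Real.sqrt_pos.2 hκ
  generalize G (κ⁻¹ * y) = g
  field_simp
  rw [sq, this]

lemma integral_exp_neg_mul_thzSurvival {α φ m c : ℝ} (hα : 0 < α) (hφ : 0 < φ) (hm : 0 < m)
    (hc : 0 < c) (μ : ℕ) :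
    ∫ v in Ioi (0 : ℝ), v ^ (-(1 / 2) : ℝ) *
        (Real.exp (-v) * thzSurvival α φ m μ (Real.sqrt (v * c))) =
      φ / α * m ^ (φ / α) * c ^ (φ / 2) * ∑ k ∈ Finset.range μ, 1 / (k.factorial : ℝ) *
        ∫ v in Ioi (0 : ℝ), v ^ ((φ + 1) / 2 - 1) * Real.exp (-v) *
          upperGamma ((α * k - φ) / α) (m * c ^ (α / 2) * v ^ (α / 2)) := by
  have hz : 0 < m * c ^ (α / 2) := by positivity
  simp only [← integral_const_mul]
  rw [← integral_finsetSum _ fun k _ ↦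
    ((integrableOn_rpow_mul_exp_neg_mul_upperGamma hα hφ hz k).const_mul _),
    ← integral_const_mul]
  refine setIntegral_congr_fun measurableSet_Ioi fun v (hv : 0 < v) ↦ ?_
  have hs : ∀ q : ℝ, Real.sqrt (v * c) ^ q = v ^ (q / 2) * c ^ (q / 2) := fun q ↦ by
    rw [Real.sqrt_eq_rpow, ← Real.rpow_mul (by positivity), Real.mul_rpow hv.le hc.le]
    ring_nf
  have he : v ^ ((φ + 1) / 2 - 1) = v ^ (-(1 / 2) : ℝ) * v ^ (φ / 2) := by
    rw [← Real.rpow_add hv]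
    ring_nf
  simp only [thzSurvival, hs, he, Finset.mul_sum]
  refine Finset.sum_congr rfl fun k _ ↦ ?_
  rw [mul_comm (v ^ (α / 2)), ← mul_assoc m]
  ring

end THzRF

theorem theorem2 {Ω : Type*} [MeasurableSpace Ω] (P : Measure Ω) [IsProbabilityMeasure P]
    (α φ S₀ hhat : ℝ) (hα : 0 < α) (hφ : 0 < φ) (hS₀ : 0 < S₀) (hhhat : 0 < hhat)
    (μ : ℕ) (hμ : 1 ≤ μ)
    (hl hg : ℂ) (hhl : hl ≠ 0) (hhg : hg ≠ 0)
    (Es Er N₁ N₂ : ℝ) (hEs : 0 < Es) (hEr : 0 < Er) (hN₁ : 0 < N₁) (hN₂ : 0 < N₂)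
    (a b : ℝ) (hb : 0 < b)
    (hpf hf : Ω → ℂ)
    (hpf_law : HasLaw (fun ω ↦ ‖hpf ω‖) (THzRF.thzLaw α φ S₀ hhat μ) P)
    (hf_law : HasLaw (fun ω ↦ ‖hf ω‖) (THzRF.rayleighLaw 1) P)
    (h_indep : IndepFun (fun ω ↦ ‖hpf ω‖) (fun ω ↦ ‖hf ω‖) P) :
    HasPDF (THzRF.e2eSNR hl hg hpf hf Es Er N₁ N₂) P volume ∧
    IntegrableOn
      (THzRF.serIntegrand P (THzRF.e2eSNR hl hg hpf hf Es Er N₁ N₂) a b) (Ioi 0) ∧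
    (∀ k ∈ Finset.range μ,
      ∃ w, THzRF.HasFoxH 2 2 (THzRF.serUpper α φ) (THzRF.serLower α φ k)
        (THzRF.serArg α S₀ hhat μ hl hg Es Er N₁ N₂ b : ℂ) w) ∧
    ((THzRF.averageSER P (THzRF.e2eSNR hl hg hpf hf Es Er N₁ N₂) a b : ℝ) : ℂ) =
      (a : ℂ) / 2 -
        ((a * Real.sqrt (b / (4 * Real.pi)) * (φ * (μ : ℝ) ^ (φ / α) / α) *
            (N₁ / (S₀ ^ 2 * hhat ^ 2 * ‖hl‖ ^ 2 * Es)) ^ (φ / 2) *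
            (N₂ / (‖hg‖ ^ 2 * Er) + b) ^ (-((φ + 1) / 2)) : ℝ) : ℂ) *
          ∑ k ∈ Finset.range μ, (1 / (k.factorial : ℂ)) *
            THzRF.foxH 2 2 (THzRF.serUpper α φ) (THzRF.serLower α φ k)
              (THzRF.serArg α S₀ hhat μ hl hg Es Er N₁ N₂ b : ℂ) := by
  have hl0 : 0 < ‖hl‖ := norm_pos_iff.2 hhl
  have hg0 : 0 < ‖hg‖ := norm_pos_iff.2 hhg
  have hμ0 : (0 : ℝ) < μ := by exact_mod_cast hμ
  have hXm := hpf_law.aemeasurable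
  have hYm := hf_law.aemeasurable
  have hXac : P.map (fun ω ↦ ‖hpf ω‖) ≪ volume.restrict (Ioi 0) := by
    rw [hpf_law.map_eq]
    exact withDensity_absolutelyContinuous _ _
  have hYac : P.map (fun ω ↦ ‖hf ω‖) ≪ volume.restrict (Ioi 0) := by
    rw [hf_law.map_eq]
    exact withDensity_absolutelyContinuous _ _
  have hpdf : HasPDF (THzRF.e2eSNR hl hg hpf hf Es Er N₁ N₂) P volume := by
    have h1m : AEMeasurable (THzRF.linkSNR hl hpf Es N₁) P := by
      rw [THzRF.linkSNR_eq]
      fun_prop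
    have h2m : AEMeasurable (THzRF.linkSNR hg hf Er N₂) P := by
      rw [THzRF.linkSNR_eq]
      fun_prop
    refine (Real.hasPDF_iff_of_aemeasurable (h1m.min h2m)).2
      (THzRF.map_min_absolutelyContinuous h1m h2m ?_ ?_)
    · rw [THzRF.linkSNR_eq]
      exact THzRF.map_mul_sq_absolutelyContinuous hXm hXac (by positivity)
    · rw [THzRF.linkSNR_eq]
      exact THzRF.map_mul_sq_absolutelyContinuous hYm hYac (by positivity)
  have hpos : ∀ᵐ ω ∂P, 0 < THzRF.e2eSNR hl hg hpf hf Es Er N₁ N₂ ω := by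
    filter_upwards [THzRF.ae_pos_of_map_absolutelyContinuous hXm hXac,
      THzRF.ae_pos_of_map_absolutelyContinuous hYm hYac] with ω h1 h2
    refine lt_min ?_ ?_ <;> rw [THzRF.linkSNR] <;> positivity
  obtain ⟨hInt, hser⟩ := THzRF.integrableOn_serIntegrand_and_averageSER_eq P _ hpos a hb
  set m : ℝ := μ * (1 / (hhat ^ α * S₀ ^ α)) with hm_def
  set c₁ : ℝ := N₁ / (‖hl‖ ^ 2 * Es) with hc₁_def
  set c₂ : ℝ := N₂ / (‖hg‖ ^ 2 * Er) with hc₂_def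
  have hm : 0 < m := by positivity
  have hc₁ : 0 < c₁ := by positivity
  have hc₂ : 0 < c₂ := by positivity
  have hβ : 0 < c₂ + b := by positivity
  have hz : THzRF.serArg α S₀ hhat μ hl hg Es Er N₁ N₂ b = m * (c₁ / (c₂ + b)) ^ (α / 2) := by
    rw [THzRF.serArg, Real.div_rpow hc₁.le hβ.le, ← hc₁_def, ← hc₂_def, hm_def]
    ring
  have hz0 : 0 < m * (c₁ / (c₂ + b)) ^ (α / 2) := by positivity
  have hfox := fun k : ℕ ↦ THzRF.hasFoxH_ser hα hφ hz0 k
  rw [hz]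
  refine ⟨hpdf, hInt, fun k _ ↦ ⟨_, hfox k⟩, ?_⟩
  have hsurv : ∀ x : ℝ, 0 < x → P.real {ω | x ≤ THzRF.e2eSNR hl hg hpf hf Es Er N₁ N₂ ω} =
      THzRF.thzSurvival α φ m μ (Real.sqrt (x * c₁)) * Real.exp (-(x * c₂)) := by
    intro x hx
    have hset : {ω | x ≤ THzRF.e2eSNR hl hg hpf hf Es Er N₁ N₂ ω} =
        (fun ω ↦ ‖hpf ω‖) ⁻¹' Ici (Real.sqrt (x * c₁)) ∩
          (fun ω ↦ ‖hf ω‖) ⁻¹' Ici (Real.sqrt (x * c₂)) := by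
      ext ω
      simp only [THzRF.e2eSNR, mem_ofPred_eq, le_min_iff, THzRF.le_linkSNR_iff hhl hpf hEs hN₁,
        THzRF.le_linkSNR_iff hhg hf hEr hN₂, mem_inter_iff, mem_preimage, mem_Ici,
        hc₁_def, hc₂_def]
    have hS0 : 0 ≤ THzRF.thzSurvival α φ m μ (Real.sqrt (x * c₁)) := by
      refine mul_nonneg (by positivity) (Finset.sum_nonneg fun k _ ↦ ?_)
      have := THzRF.upperGamma_nonneg ((α * k - φ) / α)
        (show 0 ≤ m * Real.sqrt (x * c₁) ^ α by positivity)
      positivity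
    rw [measureReal_def, hset, h_indep.measure_inter_preimage_eq_mul _ _ measurableSet_Ici
      measurableSet_Ici, ← Measure.map_apply_of_aemeasurable hXm measurableSet_Ici,
      ← Measure.map_apply_of_aemeasurable hYm measurableSet_Ici, hpf_law.map_eq, hf_law.map_eq,
      THzRF.thzLaw_Ici hα hφ hS₀ hhhat hμ (Real.sqrt_pos.2 (by positivity)),
      THzRF.rayleighLaw_one_Ici (Real.sqrt_pos.2 (by positivity)), ENNReal.toReal_mul,
      ENNReal.toReal_ofReal hS0, ENNReal.toReal_ofReal (Real.exp_pos _).le,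
      Real.sq_sqrt (by positivity)]
  -- The exponents `t²/2` and `c₂ t²/(2b)` add up to `v = t²(c₂+b)/(2b)`, which fixes the scale
  -- `2b/(c₂+b)`; then `t² c₁/(2b) = v c₁/(c₂+b)`.
  have hI : ∫ t in Ioi (0 : ℝ), Real.exp (-t ^ 2 / 2) *
      P.real {ω | t ^ 2 / (2 * b) ≤ THzRF.e2eSNR hl hg hpf hf Es Er N₁ N₂ ω} =
      ∫ t in Ioi (0 : ℝ), (fun v ↦ Real.exp (-v) *
        THzRF.thzSurvival α φ m μ (Real.sqrt (v * (c₁ / (c₂ + b)))))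
          (t ^ 2 / (2 * b / (c₂ + b))) := by
    refine setIntegral_congr_fun measurableSet_Ioi fun t (ht : 0 < t) ↦ ?_
    simp only
    rw [hsurv _ (by positivity), mul_left_comm, ← Real.exp_add, mul_comm]
    congr 2
    · field_simp
      ring
    · congr 1
      field_simp
  have hκ : 0 < 2 * b / (c₂ + b) := by positivity
  have hI' := (hI.trans (THzRF.integral_comp_sq_Ioi (fun v ↦ Real.exp (-v) *
      THzRF.thzSurvival α φ m μ (Real.sqrt (v * (c₁ / (c₂ + b))))) hκ)).trans
    (congrArg (fun I ↦ Real.sqrt (2 * b / (c₂ + b)) / 2 * I) (THzRF.integral_exp_neg_mul_thzSurvival hα hφ hm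
      (show 0 < c₁ / (c₂ + b) by positivity) μ))
  rw [hI'] at hser
  have hfox' : ∀ k : ℕ, THzRF.foxH 2 2 (THzRF.serUpper α φ) (THzRF.serLower α φ k)
      ((m * (c₁ / (c₂ + b)) ^ (α / 2) : ℝ) : ℂ) = _ := fun k ↦ (hfox k).foxH_eq
  simp only [hfox']
  have e1 : Real.sqrt (b / (4 * Real.pi)) =
      (Real.sqrt (2 * Real.pi))⁻¹ * (Real.sqrt (2 * b) / 2) := by
    rw [show b / (4 * Real.pi) = (2 * b) / (2 ^ 2 * (2 * Real.pi)) by field_simp; norm_num,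
      Real.sqrt_div (by positivity), Real.sqrt_mul (by norm_num) (2 * Real.pi),
      Real.sqrt_sq (by norm_num)]
    field_simp
  have e2 : (N₁ / (S₀ ^ 2 * hhat ^ 2 * ‖hl‖ ^ 2 * Es)) ^ (φ / 2) =
      c₁ ^ (φ / 2) / (hhat ^ φ * S₀ ^ φ) := by
    have hsq : ∀ x : ℝ, 0 < x → (x ^ 2) ^ (φ / 2) = x ^ φ := fun x hx ↦ by
      rw [← Real.rpow_natCast, ← Real.rpow_mul hx.le]
      congr 1
      push_cast
      ring
    rw [show N₁ / (S₀ ^ 2 * hhat ^ 2 * ‖hl‖ ^ 2 * Es) = c₁ / (hhat ^ 2 * S₀ ^ 2) by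
      rw [hc₁_def]; field_simp, Real.div_rpow hc₁.le (by positivity),
      Real.mul_rpow (by positivity) (by positivity), hsq _ hhhat, hsq _ hS₀]
  -- The half power comes from the Jacobian factor `√(2b/(c₂+b))`, the power `φ/2` from
  -- `(c₁/(c₂+b))^(φ/2)`.
  have e3 : (c₂ + b) ^ (-((φ + 1) / 2)) =
      (Real.sqrt (c₂ + b))⁻¹ * ((c₂ + b) ^ (φ / 2))⁻¹ := by
    rw [Real.sqrt_eq_rpow, ← Real.rpow_neg hβ.le, ← Real.rpow_neg hβ.le, ← Real.rpow_add hβ]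
    ring_nf
  rw [e1, e2, e3, hser, hm_def, THzRF.mul_one_div_rpow_div hα hS₀ hhhat hμ0.le, ← hm_def,
    Real.div_rpow hc₁.le hβ.le, Real.sqrt_div (by positivity)]
  push_cast
  ring
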